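/- Let $\mathcal C$ be a triangulated category. For a $t$-structure $\mathcal D=(\mathcal D^{\le0},\mathcal D^{\ge0})$ on $\mathcal C$ write $\mathcal D^{\le n}=\mathcal D^{\le0}[-n]$, $\mathcal D^{\ge n}=\mathcal D^{\ge0}[-n]$, $\mathcal H_{\mathcal D}=\mathcal D^{\le0}\cap\mathcal D^{\ge0}$ for its heart, $\delta^{\le n},\delta^{\ge n}$ for its truncation functors and $H^k_{\mathcal D}(X)=\delta^{\ge0}\delta^{\le0}(X[k])\in\mathcal H_{\mathcal D}$ for its cohomology. The class $\mathcal D^{\le0}$ is called the aisle of $\mathcal D$; it determines $\mathcal D$. The $t$-structure $\mathcal D$ is non-degenerate if $\bigcap_n\mathcal D^{\le n}=0=\bigcap_n\mathcal D^{\ge n}$. Let $\mathcal D$ and $\mathcal T$ be non-degenerate $t$-structures on $\mathcal C$ and let $n\in\mathbb N$. Assume that - $(\mathcal D,\mathcal T)$ is left filterable: for every $i\in\mathbb Z$ the class $\mathcal D^{\le i}\cap\mathcal T^{\le0}$ is the aisle of a $t$-structure; - $(\mathcal D,\mathcal T)$ is of type $(n,0)$: $0$ is the largest integer $k$ with $\mathcal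 T^{\le k}\subseteq\mathcal D^{\le0}$, and $n$ is the smallest natural number $m$ with $\mathcal D^{\le -m}\subseteq\mathcal T^{\le0}$. For $i\in\mathbb Z$ let ${}_i\mathcal D$ (the $i$-th left basic $t$-structure) be the $t$-structure with aisle ${}_i\mathcal D^{\le0}=\mathcal D^{\le0}\cap\mathcal T^{\le n-i}$, let ${}_i\mathcal H$ be its heart, and let ${}_i\mathcal X={}_{i+1}\mathcal D^{\le0}\cap{}_i\mathcal H$ be the $i$-th left basic torsion class. Call $\mathcal T$ left $\mathcal D$-compatible if $\delta^{\le m}(\mathcal T^{\le0})\subseteq\mathcal T^{\le0}$ for every $m\in\mathbb Z$. Then $\mathcal T$ is left $\mathcal D$-compatible if and only if ${}_i\mathcal X\subseteq\mathcal H_{\mathcal D}$ for all $0\le i\le n-1$. If these equivalent conditions hold, then $${}_{n-1}\mathcal X\subseteq{}_{n-2}\mathcal X\subseteq\dots\subseteq{}_1\mathcal X\subseteq{}_0\mathcal X\subseteq\mathcal H_{\mathcal D},$$ and for every $0\le i\le n$ $${}_i\mathcal D^{\le0}=\{C\in\mathcal C\mid H^k_{\mathcal D}(C)\in{}_{i-1+k}\mathcal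 X\text{ for } -i+1\le k\le0,\ \text{and } H^k_{\mathcal D}(C)=0\text{ for } k>0\}.$$ -/

import Mathlib

open CategoryTheory CategoryTheory.Triangulated CategoryTheory.Limits
open CategoryTheory.Pretriangulated

universe v u

namespace TPair

section

variable {C : Type u} [Category.{v} C] [Preadditive C] [HasZeroObject C] [HasShift C ℤ]
  [∀ (n : ℤ), (shiftFunctor C n).Additive] [Pretriangulated C]

/-- A t-structure is non-degenerate if the intersection of all `≤ n` parts and the
intersection of all `≥ n` parts are zero. -/
def NonDegenerate (t : TStructure C) : Prop :=
  (∀ X : C, (∀ n : ℤ, t.le n X) → IsZero X) ∧ (∀ X : C, (∀ n : ℤ, t.ge n X) → IsZero X)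

/-- A class of objects is an aisle if it is the `≤ 0` part of a t-structure. -/
def IsAisle (P : ObjectProperty C) : Prop :=
  ∃ t : TStructure C, t.le 0 = P

/-- The pair `(D, T)` is left filterable if `D^{≤ i} ∩ T^{≤ 0}` is an aisle for all `i : ℤ`. -/
def LeftFilterable (D T : TStructure C) : Prop :=
  ∀ i : ℤ, IsAisle (D.le i ⊓ T.le 0)

/-- The pair `(D, T)` has type `(n, k)` (gap `n`, shift `k`): `k` is the maximal integer with
`T^{≤ k} ⊆ D^{≤ 0}` and `n` is the minimal natural number with `D^{≤ -n} ⊆ T^{≤ k}`. -/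
def HasType (D T : TStructure C) (n : ℕ) (k : ℤ) : Prop :=
  IsGreatest {j : ℤ | T.le j ≤ D.le 0} k ∧ IsLeast {m : ℕ | D.le (-(m : ℤ)) ≤ T.le k} n

/-- `T` is left `D`-compatible: `T^{≤ 0}` is stable under all truncations `δ^{≤ n}` of `D`. -/
def LeftCompatible (D T : TStructure C) : Prop :=
  ∀ (n : ℤ) (X : C), T.le 0 X → T.le 0 ((D.truncLE n).obj X)

/-- The cohomology functors of a t-structure,
`H^i(X) = δ^{≥ 0} δ^{≤ 0} (X[i])`, regarded as functors with values in `C`. -/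
noncomputable def cohomology (t : TStructure C) (i : ℤ) : C ⥤ C :=
  shiftFunctor C i ⋙ t.truncLE 0 ⋙ t.truncGE 0

/-- The objects `H^i(X)` lie in the heart. -/
theorem cohomology_mem_heart [IsTriangulated C] (t : TStructure C) (i : ℤ) (X : C) :
    t.heart ((cohomology t i).obj X) := by
  rw [TStructure.mem_heart_iff]
  dsimp only [cohomology, Functor.comp_obj]
  exact ⟨inferInstance, inferInstance⟩

/-- The re-indexed t-structure whose `≤ n` part is `t^{≤ n + a}`. -/
def reindex (t : TStructure C) (a : ℤ) : TStructure C where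
  le n := t.le (n + a)
  ge n := t.ge (n + a)
  le_shift n b n' h X hX := t.le_shift (n + a) b (n' + a) (by omega) X hX
  ge_shift n b n' h X hX := t.ge_shift (n + a) b (n' + a) (by omega) X hX
  zero' X Y f hX hY := by
    have : t.IsLE X (0 + a) := ⟨hX⟩
    have : t.IsGE Y (1 + a) := ⟨hY⟩
    exact t.zero f (0 + a) (1 + a) (by omega)
  le_zero_le := t.le_monotone (by omega)
  ge_one_le := t.ge_antitone (by omega)
  exists_triangle_zero_one A := t.exists_triangle A (0 + a) (1 + a) (by omega)

theorem LeftFilterable.exists_tStructure {D T : TStructure C} (h : LeftFilterable D T)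
    (j : ℤ) : ∃ t : TStructure C, t.le 0 = D.le 0 ⊓ T.le j := by
  obtain ⟨t, ht⟩ := h (-j)
  refine ⟨reindex t j, ?_⟩
  change t.le (0 + j) = _
  rw [← t.shift_le j 0 (0 + j) (by omega), ht, ← D.shift_le j (-j) 0 (by omega),
    ← T.shift_le j 0 j (by omega)]
  rfl

/-- A t-structure is determined by its aisle. -/
theorem eq_of_le_zero_eq {t t' : TStructure C} (h : t.le 0 = t'.le 0) : t = t' := by
  have hle : t.le = t'.le := by
    funext n
    rw [← t.shift_le n 0 n (by omega), ← t'.shift_le n 0 n (by omega), h]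
  have hge : t.ge = t'.ge := by
    funext n
    ext X
    rw [t.ge_iff_isGE, t'.ge_iff_isGE, t.isGE_iff_orthogonal (n - 1) n (by omega),
      t'.isGE_iff_orthogonal (n - 1) n (by omega)]
    simp only [← TStructure.le_iff_isLE, hle]
  cases t
  cases t'
  cases hle
  cases hge
  rfl

/-- For a left filterable pair `(D, T)` with `D^{≤ -m} ⊆ T^{≤ 0} ⊆ D^{≤ 0}`, the `i`-th left basic
t-structure: the (unique) t-structure whose aisle is `D^{≤ 0} ∩ T^{≤ m - i}`. -/
noncomputable def leftBasic {D T : TStructure C} (h : LeftFilterable D T) (m i : ℤ) :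
    TStructure C :=
  (h.exists_tStructure (m - i)).choose

theorem leftBasic_le_zero {D T : TStructure C} (h : LeftFilterable D T) (m i : ℤ) :
    (leftBasic h m i).le 0 = D.le 0 ⊓ T.le (m - i) :=
  (h.exists_tStructure (m - i)).choose_spec

/-- The `i`-th left basic torsion class: the intersection of the aisle of the `(i + 1)`-st left
basic t-structure with the heart of the `i`-th one. -/
noncomputable def leftTorsionClass {D T : TStructure C} (h : LeftFilterable D T) (m i : ℤ) :
    ObjectProperty C :=
  (leftBasic h m (i + 1)).le 0 ⊓ (leftBasic h m i).heart

end

end TPair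

/-!
The left basic t-structures interpolate between `₀D = D` and `ₙD = T`, and the aisle of `ᵢ₊₁D` lies
between `ᵢD^{≤ -1}` and `ᵢD^{≤ 0}`. Hence an object `A` of that aisle is an extension of an object
of `ᵢX` by the truncation of `A` in `ᵢD^{≤ -1}`. If `ᵢX` lies in the heart of `D`, then the latter
truncation is also `δ^{≤ -1} A`, so the stability under the truncations of `D` passes from the
aisle of `ᵢD` to that of `ᵢ₊₁D`, and by induction from `D` to `T`. Conversely, if `T` is left
`D`-compatible, then for `A` in `ᵢX` the truncation `δ^{≤ -1} A` lies in `ᵢD^{≤ -1}`, so that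
its map to `A` vanishes and `A` lies in the heart of `D`; thus `ᵢX` is the intersection of that
heart with `T^{≤ n - i - 1}`. The description of the aisles then follows by dévissage along the
truncations `δ^{≤ k} A`.
-/

namespace TPair

section

variable {C : Type u} [Category.{v} C] [Preadditive C] [HasZeroObject C] [HasShift C ℤ]
  [∀ (n : ℤ), (shiftFunctor C n).Additive] [Pretriangulated C]

instance (t : TStructure C) (n : ℤ) : (t.le n).IsTriangulatedClosed₂ :=
  .mk' fun S hS h₁ h₃ ↦ (t.isLE₂ S hS n ⟨h₁⟩ ⟨h₃⟩).le

theorem le_le_le_of_sub_eq_sub {t t' : TStructure C} {a b c d : ℤ} (h : t.le a ≤ t'.le b)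
    (hcd : c - a = d - b) : t.le c ≤ t'.le d := by
  rw [← t.shift_le (c - a) a c (by lia), ← t'.shift_le (c - a) b d (by lia)]
  exact fun X hX ↦ h _ hX

theorem ge_add_one_le_ge_add_one {t t' : TStructure C} {a b : ℤ} (h : t.le a ≤ t'.le b) :
    t'.ge (b + 1) ≤ t.ge (a + 1) := by
  intro X hX
  rw [t'.ge_iff_isGE] at hX
  rw [t.ge_iff_isGE, t.isGE_iff_orthogonal a (a + 1) rfl]
  exact fun Y f hY ↦ t'.zero_of_isLE_of_isGE f b (b + 1) (by lia) ⟨h Y hY.le⟩ hX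

theorem nonempty_iso_triangleLEGE (t : TStructure C) {S : Triangle C} (hS : S ∈ distTriang C)
    (a b : ℤ) (hab : a + 1 = b) (h₁ : t.IsLE S.obj₁ a) (h₃ : t.IsGE S.obj₃ b) :
    Nonempty (S ≅ (t.triangleLEGE a b hab).obj S.obj₂) := by
  obtain ⟨e, -⟩ := t.triangle_iso_exists hS (t.triangleLEGE_distinguished a b hab S.obj₂)
    (Iso.refl _) a b h₁ h₃ (inferInstanceAs (t.IsLE ((t.truncLE a).obj S.obj₂) a))
    (inferInstanceAs (t.IsGE ((t.truncGE b).obj S.obj₂) b))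
  exact ⟨e⟩

theorem nonempty_shift_triangleLEGE_iso (t : TStructure C) (X : C) (k a b : ℤ)
    (hab : a + 1 = b) :
    Nonempty ((Triangle.shiftFunctor C k).obj ((t.triangleLEGE (k + a) (k + b) (by lia)).obj X) ≅
      (t.triangleLEGE a b hab).obj (X⟦k⟧)) :=
  nonempty_iso_triangleLEGE t
    (Triangle.shift_distinguished _ (t.triangleLEGE_distinguished _ _ _ X) k) a b hab
    (t.isLE_shift ((t.truncLE (k + a)).obj X) (k + a) k a)
    (t.isGE_shift ((t.truncGE (k + b)).obj X) (k + b) k b)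

theorem nonempty_truncLE_obj_shift_iso (t : TStructure C) (X : C) (k a : ℤ) :
    Nonempty (((t.truncLE (k + a)).obj X)⟦k⟧ ≅ (t.truncLE a).obj (X⟦k⟧)) :=
  (nonempty_shift_triangleLEGE_iso t X k a (a + 1) rfl).map Triangle.π₁.mapIso

theorem nonempty_truncGE_obj_shift_iso (t : TStructure C) (X : C) (k b : ℤ) :
    Nonempty (((t.truncGE (k + b)).obj X)⟦k⟧ ≅ (t.truncGE b).obj (X⟦k⟧)) :=
  (nonempty_shift_triangleLEGE_iso t X k (b - 1) b (by lia)).map Triangle.π₃.mapIso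

theorem nonempty_cohomology_obj_iso (t : TStructure C) (X : C) (k : ℤ) :
    Nonempty ((cohomology t k).obj X ≅ ((t.truncGELE k k).obj X)⟦k⟧) := by
  obtain ⟨eLE⟩ := nonempty_truncLE_obj_shift_iso t X k 0
  obtain ⟨eGE⟩ := nonempty_truncGE_obj_shift_iso t ((t.truncLE (k + 0)).obj X) k 0
  rw [add_zero] at eLE eGE
  exact ⟨(t.truncGE 0).mapIso eLE.symm ≪≫ eGE.symm⟩

theorem prop_truncLE_of_prop_cohomology [IsTriangulated C] (t : TStructure C)
    (P : ObjectProperty C) [P.IsClosedUnderIsomorphisms] [P.IsTriangulatedClosed₂] (X : C)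
    {a b : ℤ} (hab : a ≤ b) (ha : P ((t.truncLE a).obj X))
    (hP : ∀ k, a < k → k ≤ b → P (((cohomology t k).obj X)⟦-k⟧)) :
    P ((t.truncLE b).obj X) := by
  induction b, hab using Int.leInduction with
  | base => exact ha
  | succ b hab ih =>
    obtain ⟨e⟩ := nonempty_cohomology_obj_iso t X (b + 1)
    have hb : P ((t.truncLE b).obj X) := ih fun k hak hkb ↦ hP k hak (by lia)
    have hb' : P ((t.truncGELE (b + 1) (b + 1)).obj X) :=
      P.prop_of_iso ((shiftFunctor C (-(b + 1))).mapIso e ≪≫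
        (shiftEquiv C (b + 1)).unitIso.symm.app _) (hP (b + 1) (by lia) le_rfl)
    exact P.ext_of_isTriangulatedClosed₂ _
      (t.triangleLTLTGELT_distinguished (b + 1) (b + 1 + 1) (by lia) X) hb hb'

theorem isZero_cohomology_of_isLE [IsTriangulated C] (t : TStructure C) (X : C) (a k : ℤ)
    (hak : a < k) [t.IsLE X a] : IsZero ((cohomology t k).obj X) := by
  have : t.IsLE (X⟦k⟧) (a - k) := t.isLE_shift X a k (a - k)
  have : t.IsLE ((cohomology t k).obj X) (a - k) :=
    inferInstanceAs (t.IsLE ((t.truncGE 0).obj ((t.truncLE 0).obj (X⟦k⟧))) (a - k))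
  have : t.IsGE ((cohomology t k).obj X) 0 := ⟨(cohomology_mem_heart t k X).2⟩
  exact t.isZero _ (a - k) 0

theorem isLE_iff_isZero_cohomology [IsTriangulated C] {t : TStructure C}
    (ht : ∀ X : C, (∀ n : ℤ, t.ge n X) → IsZero X) (X : C) (a : ℤ) :
    t.IsLE X a ↔ ∀ k, a < k → IsZero ((cohomology t k).obj X) := by
  refine ⟨fun _ k hk ↦ isZero_cohomology_of_isLE t X a k hk, fun h ↦ ?_⟩
  have isGE_truncGT (b : ℤ) (hab : a ≤ b) : t.IsGE ((t.truncGT a).obj X) (b + 1) := by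
    have : t.le a ((t.truncLE b).obj X) :=
      prop_truncLE_of_prop_cohomology t (t.le a) X hab (t.le_of_isLE _ a)
        fun k hk _ ↦ (t.isLE_of_isZero ((shiftFunctor C (-k)).map_isZero (h k hk)) a).le
    rw [t.le_iff_isLE, t.isLE_iff_isZero_truncGT_obj] at this
    rw [t.isGE_iff_isZero_truncLE_obj b (b + 1) rfl]
    exact this.of_iso ((t.truncGELEIsoLEGE (a + 1) b).app X).symm
  rw [t.isLE_iff_isZero_truncGT_obj]
  refine ht _ fun b ↦ ?_
  have := isGE_truncGT (max a b) (le_max_left a b)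
  exact (t.isGE_of_ge _ b (max a b + 1)).ge

theorem isLE_truncGE_of_isLE_truncLE (t t' : TStructure C) (X : C) (a b n : ℤ) (hab : a + 1 = b)
    [t'.IsLE ((t.truncLE a).obj X) (n + 1)] [t'.IsLE X n] :
    t'.IsLE ((t.truncGE b).obj X) n :=
  t'.isLE₂ _ (rot_of_distTriang _ (t.triangleLEGE_distinguished a b hab X)) n ‹_›
    (t'.isLE_shift ((t.truncLE a).obj X) (n + 1) 1 n)

end

section LeftCompatible

variable {C : Type u} [Category.{v} C] [Preadditive C] [HasZeroObject C] [HasShift C ℤ]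
  [∀ (n : ℤ), (shiftFunctor C n).Additive] [Pretriangulated C] {D T t t' : TStructure C}

theorem leftCompatible_self (D : TStructure C) : LeftCompatible D D := by
  intro n X hX
  rw [D.le_iff_isLE] at hX ⊢
  infer_instance

namespace LeftCompatible

theorem isLE_truncLE (h : LeftCompatible D T) (X : C) (a j : ℤ) [T.IsLE X j] :
    T.IsLE ((D.truncLE a).obj X) j := by
  obtain ⟨e⟩ := nonempty_truncLE_obj_shift_iso D X j (a - j)
  rw [add_sub_cancel] at e
  have : T.IsLE ((D.truncLE (a - j)).obj (X⟦j⟧)) 0 := ⟨h _ _ (T.isLE_shift X j j 0).le⟩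
  have := T.isLE_of_iso e.symm 0
  exact T.isLE_of_shift _ j j 0

theorem isLE_truncGE (h : LeftCompatible D T) (X : C) (a j : ℤ) [T.IsLE X j] :
    T.IsLE ((D.truncGE a).obj X) j := by
  have := h.isLE_truncLE X (a - 1) j
  have := T.isLE_of_le ((D.truncLE (a - 1)).obj X) j (j + 1)
  exact isLE_truncGE_of_isLE_truncLE D T X (a - 1) a j (by lia)

theorem isLE_cohomology (h : LeftCompatible D T) (X : C) (j k : ℤ) [T.IsLE X j] :
    T.IsLE ((cohomology D k).obj X) (j - k) := by
  have := T.isLE_shift X j k (j - k)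
  have := h.isLE_truncLE (X⟦k⟧) 0 (j - k)
  exact h.isLE_truncGE _ 0 (j - k)

theorem isLE_iff_isLE_cohomology [IsTriangulated C] (h : LeftCompatible D T) {a j : ℤ}
    (hDT : D.le a ≤ T.le j) (X : C) (b : ℤ) [D.IsLE X b] :
    T.IsLE X j ↔ ∀ k, a < k → k ≤ b → T.IsLE ((cohomology D k).obj X) (j - k) := by
  refine ⟨fun _ k _ _ ↦ h.isLE_cohomology X j k, fun hX ↦ ?_⟩
  rcases le_total a b with hab | hba
  · have : T.le j ((D.truncLE b).obj X) :=
      prop_truncLE_of_prop_cohomology D (T.le j) X hab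
        (hDT _ (D.le_of_isLE _ a)) fun k hak hkb ↦
          have := hX k hak hkb
          (T.isLE_shift ((cohomology D k).obj X) (j - k) (-k) j).le
    exact ⟨(T.le j).prop_of_iso (asIso ((D.truncLEι b).app X)) this⟩
  · have := D.isLE_of_le X b a
    exact ⟨hDT X (D.le_of_isLE X a)⟩

theorem of_le_zero_eq_inf (h : LeftCompatible D T) {a j : ℤ}
    (ht : t.le 0 = D.le a ⊓ T.le j) : LeftCompatible D t := by
  intro m X hX
  rw [ht] at hX ⊢
  have : D.IsLE X a := ⟨hX.1⟩
  have : T.IsLE X j := ⟨hX.2⟩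
  exact ⟨D.le_of_isLE _ a, (h.isLE_truncLE X m j).le⟩

theorem inf_ge_zero_le_ge_zero (h : LeftCompatible D t')
    (ht : t'.le 0 ⊓ D.le (-1) ≤ t.le (-1)) : t'.le 0 ⊓ t.ge 0 ≤ D.ge 0 := by
  rintro X ⟨hX, hX'⟩
  have : t.le (-1) ((D.truncLE (-1)).obj X) :=
    ht _ ⟨h (-1) X hX, D.le_of_isLE _ (-1)⟩
  have truncLEι_eq_zero : (D.truncLEι (-1)).app X = 0 :=
    t.zero_of_isLE_of_isGE _ (-1) 0 (by lia) ⟨this⟩ ⟨hX'⟩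
  rw [D.ge_iff_isGE, D.isGE_iff_isZero_truncLE_obj (-1) 0 (by lia), IsZero.iff_id_eq_zero]
  exact D.to_truncLE_obj_ext (by rw [truncLEι_eq_zero, comp_zero, comp_zero])

theorem of_inf_heart_le_ge [IsTriangulated C] (h : LeftCompatible D t) (htD : t.le 0 ≤ D.le 0)
    (hlower : t.le (-1) ≤ t'.le 0) (hupper : t'.le 0 ≤ t.le 0)
    (hheart : t'.le 0 ⊓ t.heart ≤ D.ge 0) : LeftCompatible D t' := by
  intro m X hX
  have : t'.IsLE X 0 := ⟨hX⟩
  have : t.IsLE X 0 := ⟨hupper X hX⟩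
  have : D.IsLE X 0 := ⟨htD X (t.le_of_isLE X 0)⟩
  rcases le_or_gt 0 m with hm | hm
  · have := D.isLE_of_le X 0 m
    exact (t'.le 0).prop_of_iso (asIso ((D.truncLEι m).app X)).symm hX
  · have : t'.IsLE ((t.truncLE (-1)).obj X) (0 + 1) :=
      ⟨t'.le_monotone (by lia) _ (hlower _ (t.isLE_truncLE_obj X (-1) (-1)).le)⟩
    have : t'.IsLE ((t.truncGE 0).obj X) 0 :=
      isLE_truncGE_of_isLE_truncLE t t' X (-1) 0 0 (by lia)
    have truncGE_mem : D.ge 0 ((t.truncGE 0).obj X) :=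
      hheart _ ⟨this.le, t.le_of_isLE _ 0, t.ge_of_isGE _ 0⟩
    have truncLE_mem : D.le (-1) ((t.truncLE (-1)).obj X) :=
      le_le_le_of_sub_eq_sub htD rfl _ (t.isLE_truncLE_obj X (-1) (-1)).le
    obtain ⟨φ⟩ := nonempty_iso_triangleLEGE D (t.triangleLEGE_distinguished (-1) 0 (by lia) X)
      (-1) 0 (by lia) ⟨truncLE_mem⟩ ⟨truncGE_mem⟩
    have e : (t.truncLE (-1)).obj X ≅ (D.truncLE (-1)).obj X :=
      (Triangle.π₁.mapIso φ :)
    have := D.isIso_truncLE_map_truncLEι_app m (-1) (by lia) X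
    exact (t'.le 0).prop_of_iso
      ((D.truncLE m).mapIso e ≪≫ asIso ((D.truncLE m).map ((D.truncLEι (-1)).app X)))
      (hlower _ (h.isLE_truncLE _ m (-1)).le)

end LeftCompatible

end LeftCompatible

section LeftBasic

variable {C : Type u} [Category.{v} C] [Preadditive C] [HasZeroObject C] [HasShift C ℤ]
  [∀ (n : ℤ), (shiftFunctor C n).Additive] [Pretriangulated C] {D T : TStructure C}
  (hfil : LeftFilterable D T)

theorem leftBasic_le (m i a : ℤ) :
    (leftBasic hfil m i).le a = D.le a ⊓ T.le (m - i + a) := by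
  rw [← (leftBasic hfil m i).shift_le a 0 a (by lia), leftBasic_le_zero,
    ← D.shift_le a 0 a (by lia), ← T.shift_le a (m - i) (m - i + a) (by lia)]
  rfl

theorem leftBasic_zero {m : ℤ} (hDT : D.le (-m) ≤ T.le 0) : leftBasic hfil m 0 = D := by
  refine eq_of_le_zero_eq ?_
  rw [leftBasic_le_zero, inf_eq_left]
  exact le_le_le_of_sub_eq_sub hDT (by lia)

theorem leftBasic_self (hTD : T.le 0 ≤ D.le 0) (m : ℤ) : leftBasic hfil m m = T := by
  refine eq_of_le_zero_eq ?_
  rwa [leftBasic_le_zero, sub_self, inf_eq_right]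

theorem leftBasic_add_one_le_zero_le (m i : ℤ) :
    (leftBasic hfil m (i + 1)).le 0 ≤ (leftBasic hfil m i).le 0 := by
  rw [leftBasic_le_zero, leftBasic_le_zero]
  exact inf_le_inf_left _ (T.le_monotone (by lia))

theorem leftBasic_le_neg_one_le (m i : ℤ) :
    (leftBasic hfil m i).le (-1) ≤ (leftBasic hfil m (i + 1)).le 0 := by
  rw [leftBasic_le, leftBasic_le]
  exact inf_le_inf (D.le_monotone (by lia)) (T.le_monotone (by lia))

theorem leftBasic_le_zero_le_left (m i : ℤ) : (leftBasic hfil m i).le 0 ≤ D.le 0 :=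
  (leftBasic_le_zero hfil m i).trans_le inf_le_left

theorem LeftCompatible.leftBasic_add_one [IsTriangulated C] {m i : ℤ}
    (h : LeftCompatible D (leftBasic hfil m i)) (hX : leftTorsionClass hfil m i ≤ D.heart) :
    LeftCompatible D (leftBasic hfil m (i + 1)) :=
  h.of_inf_heart_le_ge (leftBasic_le_zero_le_left hfil m i) (leftBasic_le_neg_one_le hfil m i)
    (leftBasic_add_one_le_zero_le hfil m i) (hX.trans inf_le_right)

theorem leftCompatible_of_leftTorsionClass_le_heart [IsTriangulated C] {m : ℤ} (hm : 0 ≤ m)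
    (hDT : D.le (-m) ≤ T.le 0) (hTD : T.le 0 ≤ D.le 0)
    (hX : ∀ i, 0 ≤ i → i < m → leftTorsionClass hfil m i ≤ D.heart) : LeftCompatible D T := by
  suffices ∀ i, 0 ≤ i → i ≤ m → LeftCompatible D (leftBasic hfil m i) by
    simpa only [leftBasic_self hfil hTD] using this m hm le_rfl
  intro i hi
  induction i, hi using Int.leInduction with
  | base =>
    intro _
    rw [leftBasic_zero hfil hDT]
    exact leftCompatible_self D
  | succ i hi ih => exact fun him ↦ (ih (by lia)).leftBasic_add_one hfil (hX i hi (by lia))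

theorem LeftCompatible.leftTorsionClass_le_heart (h : LeftCompatible D T)
    (m i : ℤ) : leftTorsionClass hfil m i ≤ D.heart := by
  have hcompat : LeftCompatible D (leftBasic hfil m (i + 1)) :=
    h.of_le_zero_eq_inf (leftBasic_le_zero hfil m (i + 1))
  have hlower : (leftBasic hfil m (i + 1)).le 0 ⊓ D.le (-1) ≤ (leftBasic hfil m i).le (-1) := by
    rw [leftBasic_le_zero, leftBasic_le]
    exact le_inf inf_le_right ((inf_le_left.trans inf_le_right).trans (T.le_monotone (by lia)))
  exact le_inf (inf_le_left.trans (leftBasic_le_zero_le_left hfil m (i + 1)))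
    ((inf_le_inf_left _ inf_le_right).trans (hcompat.inf_ge_zero_le_ge_zero hlower))

theorem LeftCompatible.leftTorsionClass_eq (h : LeftCompatible D T)
    (m i : ℤ) : leftTorsionClass hfil m i = D.heart ⊓ T.le (m - (i + 1)) := by
  refine le_antisymm (le_inf (h.leftTorsionClass_le_heart hfil m i) ?_) fun X hX ↦ ?_
  · exact inf_le_left.trans ((leftBasic_le_zero hfil m (i + 1)).trans_le inf_le_right)
  · have hle : (leftBasic hfil m (i + 1)).le 0 X := by
      rw [leftBasic_le_zero]
      exact ⟨hX.1.1, hX.2⟩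
    have hge : D.ge 0 ≤ (leftBasic hfil m i).ge 0 :=
      ge_add_one_le_ge_add_one (a := -1) (b := -1)
        (le_le_le_of_sub_eq_sub (leftBasic_le_zero_le_left hfil m i) rfl)
    exact ⟨hle, leftBasic_add_one_le_zero_le hfil m i X hle, hge X hX.1.2⟩

theorem LeftCompatible.antitone_leftTorsionClass (h : LeftCompatible D T)
    (m : ℤ) : Antitone (leftTorsionClass hfil m) := by
  intro i j hij
  rw [h.leftTorsionClass_eq, h.leftTorsionClass_eq]
  exact inf_le_inf_left _ (T.le_monotone (by lia))

theorem LeftCompatible.leftBasic_le_zero_iff_cohomology [IsTriangulated C]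
    (h : LeftCompatible D T) (hD : ∀ X : C, (∀ n : ℤ, D.ge n X) → IsZero X) {m : ℤ}
    (hDT : D.le (-m) ≤ T.le 0) (i : ℤ) (X : C) :
    (leftBasic hfil m i).le 0 X ↔
      (∀ k : ℤ, -i + 1 ≤ k → k ≤ 0 →
        leftTorsionClass hfil m (i - 1 + k) ((cohomology D k).obj X)) ∧
      (∀ k : ℤ, 0 < k → IsZero ((cohomology D k).obj X)) := by
  have hDT' : D.le (-i) ≤ T.le (m - i) := le_le_le_of_sub_eq_sub hDT (by lia)
  have leftTorsionClass_iff (k : ℤ) :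
      leftTorsionClass hfil m (i - 1 + k) ((cohomology D k).obj X) ↔
        T.IsLE ((cohomology D k).obj X) (m - i - k) := by
    rw [h.leftTorsionClass_eq, show m - (i - 1 + k + 1) = m - i - k by lia, ← T.le_iff_isLE]
    exact and_iff_right (cohomology_mem_heart D k X)
  rw [leftBasic_le_zero, ← isLE_iff_isZero_cohomology hD, and_comm]
  simp only [leftTorsionClass_iff, Int.add_one_le_iff]
  exact (and_congr (D.le_iff_isLE X 0) (T.le_iff_isLE X (m - i))).trans
    (and_congr_right fun _ ↦ h.isLE_iff_isLE_cohomology hDT' X 0)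

end LeftBasic

end TPair

theorem mainTheorem5_general {C : Type u} [Category.{v} C] [Preadditive C] [HasZeroObject C]
    [HasShift C ℤ] [∀ (n : ℤ), (shiftFunctor C n).Additive] [Pretriangulated C]
    [IsTriangulated C] (D T : TStructure C)
    (hD : ∀ X : C, (∀ k : ℤ, D.ge k X) → IsZero X)
    (n : ℕ) (hfil : TPair.LeftFilterable D T)
    (hDT : D.le (-(n : ℤ)) ≤ T.le 0) (hTD : T.le 0 ≤ D.le 0) :
    (TPair.LeftCompatible D T ↔
      ∀ i : ℤ, 0 ≤ i → i < n → TPair.leftTorsionClass hfil n i ≤ D.heart) ∧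
    (TPair.LeftCompatible D T →
      Antitone (TPair.leftTorsionClass hfil n) ∧
      (∀ i : ℤ, TPair.leftTorsionClass hfil n i ≤ D.heart) ∧
      (∀ (i : ℤ) (X : C),
        (TPair.leftBasic hfil n i).le 0 X ↔
          (∀ k : ℤ, -i + 1 ≤ k → k ≤ 0 →
            TPair.leftTorsionClass hfil n (i - 1 + k) ((TPair.cohomology D k).obj X)) ∧
          (∀ k : ℤ, 0 < k → IsZero ((TPair.cohomology D k).obj X)))) :=
  ⟨⟨fun h i _ _ ↦ h.leftTorsionClass_le_heart hfil n i,
    TPair.leftCompatible_of_leftTorsionClass_le_heart hfil n.cast_nonneg hDT hTD⟩,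
    fun h ↦ ⟨h.antitone_leftTorsionClass hfil n, h.leftTorsionClass_le_heart hfil n,
      h.leftBasic_le_zero_iff_cohomology hfil hD hDT⟩⟩

theorem mainTheorem5 {C : Type u} [Category.{v} C] [Preadditive C] [HasZeroObject C]
    [HasShift C ℤ] [∀ (n : ℤ), (shiftFunctor C n).Additive] [Pretriangulated C]
    [IsTriangulated C] (D T : TStructure C)
    (hD : TPair.NonDegenerate D) (hT : TPair.NonDegenerate T)
    (n : ℕ) (hfil : TPair.LeftFilterable D T) (htype : TPair.HasType D T n 0) :
    (TPair.LeftCompatible D T ↔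
      ∀ i : ℤ, 0 ≤ i → i < n → TPair.leftTorsionClass hfil n i ≤ D.heart) ∧
    (TPair.LeftCompatible D T →
      (∀ i : ℤ, 0 ≤ i → i + 1 < n →
        TPair.leftTorsionClass hfil n (i + 1) ≤ TPair.leftTorsionClass hfil n i) ∧
      (0 < n → TPair.leftTorsionClass hfil n 0 ≤ D.heart) ∧
      (∀ i : ℤ, 0 ≤ i → i ≤ n → ∀ X : C,
        (TPair.leftBasic hfil n i).le 0 X ↔
          (∀ k : ℤ, -i + 1 ≤ k → k ≤ 0 →
            TPair.leftTorsionClass hfil n (i - 1 + k) ((TPair.cohomology D k).obj X)) ∧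
          (∀ k : ℤ, 0 < k → IsZero ((TPair.cohomology D k).obj X)))) := by
  obtain ⟨hiff, h⟩ := mainTheorem5_general D T hD.2 n hfil htype.2.1 htype.1.1
  exact ⟨hiff, fun hc ↦ ⟨fun i _ _ ↦ (h hc).1 (by lia), fun _ ↦ (h hc).2.1 0,
    fun i _ _ ↦ (h hc).2.2 i⟩⟩
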